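/- Let $d\ge 1$ and $s>2d$, and let $\|\cdot\|$ be the Euclidean norm. Let $\{p_k\}_{k\in\mathbb Z^d}$ satisfy $p_k\in[0,1]$ and $p_k=p_{-k}$ for every $k$, and suppose that the limit $\lim_{\|k\|\to\infty} p_k/\|k\|^{-s}$ exists and lies in $(0,\infty)$. Consider long-range percolation on $\mathbb Z^d$: independently for every unordered pair $\{i,j\}$ of distinct sites of $\mathbb Z^d$, the edge between $i$ and $j$ is open with probability $p_{i-j}$ and closed otherwise. Let $D(x,y)\in\{0,1,2,\dots\}\cup\{\infty\}$ be the graph distance between $x$ and $y$ in the random graph of open edges, with $D(x,y)=\infty$ if $x$ and $y$ are not connected. Then, almost surely, $$\liminf_{\|x\|\to\infty}\frac{D(0,x)}{\|x\|}>0.$$ -/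

import Mathlib

open Filter Topology MeasureTheory ProbabilityTheory
open scoped ENNReal

/-- The Euclidean norm of a lattice point of `ℤ^d`. -/
noncomputable def latticeNorm {d : ℕ} (x : Fin d → ℤ) : ℝ :=
  ‖(WithLp.toLp 2 (fun i => (x i : ℝ)) : EuclideanSpace ℝ (Fin d))‖

/-- The filter `‖x‖ → ∞` on `ℤ^d`. -/
noncomputable def latticeAtInfinity (d : ℕ) : Filter (Fin d → ℤ) :=
  Filter.comap latticeNorm Filter.atTop

/-- `ω` is a long-range percolation configuration on `ℤ^d` with edge probabilities `p`: the bond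
variables `ω {i, j}` (`true` meaning open), indexed by unordered pairs of distinct sites, are
independent, and the bond between `i` and `j` is open with probability `p (i - j)`.
Nothing is required of the values of `ω` on the diagonal pairs `{i, i}`, which are not bonds. -/
structure IsLongRangePercolation {d : ℕ} {Ω : Type*} [MeasurableSpace Ω] (μ : Measure Ω)
    (p : (Fin d → ℤ) → ℝ) (ω : Sym2 (Fin d → ℤ) → Ω → Bool) : Prop where
  measurable : ∀ e, ¬ e.IsDiag → Measurable (ω e)
  prob_open : ∀ i j, i ≠ j → μ {a | ω s(i, j) a = true} = ENNReal.ofReal (p (i - j))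
  indep : iIndepFun (fun e : {e : Sym2 (Fin d → ℤ) // ¬ e.IsDiag} => ω e) μ

/-- The random graph on `ℤ^d`, at the sample point `a`: distinct sites `i`, `j` are adjacent
if and only if the bond `{i, j}` is open. -/
def openGraph {d : ℕ} {Ω : Type*} (ω : Sym2 (Fin d → ℤ) → Ω → Bool) (a : Ω) :
    SimpleGraph (Fin d → ℤ) :=
  SimpleGraph.fromEdgeSet {e | ω e a = true}

/-- The chemical distance `D(x, y)`: the graph distance in the random graph, with value `∞` when
`x` and `y` are not connected. -/
noncomputable def chemicalDist {d : ℕ} {Ω : Type*} (ω : Sym2 (Fin d → ℤ) → Ω → Bool) (a : Ω)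
    (x y : Fin d → ℤ) : ℝ≥0∞ :=
  ((openGraph ω a).edist x y : ℝ≥0∞)

/-! The proof is a renormalisation in the sup norm, whose balls are boxes. Write `N` for a length
scale, `n` for the time allotted to it, `q` for a bound on the probability of a fast crossing. Since
`s > 2d`, a box of side of order `N` contains an edge of length at least `N` with probability `O(N ^
(2d - s))`, which tends to zero.

Suppose that a box of scale `R N` has no such edge and that its fast crossings of scale `N` all lie
near one place. A walk then gains only a bounded multiple of `N` at that place and elsewhere
advances at most `N` per `n` steps (`norm_sub_le_of_not_isIrregular`), so it cannot cover `R N` in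
`n (R - 18)` steps. Fast crossings at separated places use disjoint sets of bonds, hence are
independent, so the next `q` is at most `(9R) ^ (2d) (q ^ 2 + C N ^ (2d - s))`.

With ratios `R = 2 ^ (k + j)` the bound `q ≤ R ^ (-4d)` propagates (`exists_scales`), while the
speed, multiplied by `R / (R - 18)` at each scale, stays bounded because `∑ 18 / R` converges
(`scaleLength_le_scaleTime`). By Borel–Cantelli the boxes around the origin are regular at all large
scales, and on that event every walk from `0` to a distant `x` has length at least a constant times
`‖x‖` (`norm_le_mul_length`). -/

/-! ### Paths, fast crossings and irregular boxes -/

/-- `x 0, …, x ℓ` is a walk of `G` inside the closed sup-norm ball of radius `r` around `v`. -/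
def IsWalkInBall {d : ℕ} (G : SimpleGraph (Fin d → ℤ)) (v : Fin d → ℤ) (r : ℝ)
    (x : ℕ → Fin d → ℤ) (l : ℕ) : Prop :=
  (∀ i ≤ l, ‖x i - v‖ ≤ r) ∧ ∀ i < l, G.Adj (x i) (x (i + 1))

/-- Some walk of at most `n` steps near `v` covers a distance at least `N`. -/
def HasFastCrossing {d : ℕ} (G : SimpleGraph (Fin d → ℤ)) (v : Fin d → ℤ) (N n : ℕ) : Prop :=
  ∃ (x : ℕ → Fin d → ℤ) (l : ℕ), l ≤ n ∧ IsWalkInBall G v (3 * N) x l ∧ (N : ℝ) ≤ ‖x l - x 0‖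

/-- Some edge inside the ball of radius `r` around `v` has length at least `N`. -/
def HasLongEdge {d : ℕ} (G : SimpleGraph (Fin d → ℤ)) (v : Fin d → ℤ) (r : ℝ) (N : ℕ) : Prop :=
  ∃ x y, ‖x - v‖ ≤ r ∧ ‖y - v‖ ≤ r ∧ G.Adj x y ∧ (N : ℝ) ≤ ‖x - y‖

/-- Two far apart points of `N ℤ^d` near `v` both have fast crossings nearby. -/
def HasSeparatedCrossings {d : ℕ} (G : SimpleGraph (Fin d → ℤ)) (v : Fin d → ℤ) (r : ℝ)
    (N n : ℕ) : Prop :=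
  ∃ z w : Fin d → ℤ, ‖(N : ℤ) • z - v‖ ≤ r ∧ ‖(N : ℤ) • w - v‖ ≤ r ∧
    6 * (N : ℝ) < ‖(N : ℤ) • z - (N : ℤ) • w‖ ∧
    HasFastCrossing G ((N : ℤ) • z) N n ∧ HasFastCrossing G ((N : ℤ) • w) N n

/-- The box of scale `R * N` around `v` has a long edge or two separated fast crossings of
scale `N`. -/
def IsIrregular {d : ℕ} (G : SimpleGraph (Fin d → ℤ)) (v : Fin d → ℤ) (R N n : ℕ) : Prop :=
  HasLongEdge G v (3 * (R * N)) N ∨ HasSeparatedCrossings G v ((3 * R + 1) * N) N n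

lemma IsWalkInBall.shift {d : ℕ} {G : SimpleGraph (Fin d → ℤ)} {v : Fin d → ℤ} {r : ℝ}
    {x : ℕ → Fin d → ℤ} {l : ℕ} (h : IsWalkInBall G v r x l) (a : ℕ) {m : ℕ} (hm : a + m ≤ l) :
    IsWalkInBall G v r (fun i => x (a + i)) m :=
  ⟨fun i hi => h.1 _ (by omega), fun i hi => h.2 (a + i) (by omega)⟩

lemma exists_smul_near {d : ℕ} (v : Fin d → ℤ) {N : ℕ} (hN : 0 < N) :
    ∃ z : Fin d → ℤ, ‖v - (N : ℤ) • z‖ ≤ N := by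
  refine ⟨fun i => v i / N, (pi_norm_le_iff_of_nonneg (by positivity)).2 fun i => ?_⟩
  have h1 := Int.emod_add_mul_ediv (v i) N
  have h2 := Int.emod_nonneg (v i) (b := (N : ℤ)) (by omega)
  have h3 := Int.emod_lt_of_pos (v i) (b := (N : ℤ)) (by omega)
  have h4 : (v - (N : ℤ) • fun i => v i / N) i = v i % N := by
    simp only [Pi.sub_apply, Pi.smul_apply, smul_eq_mul]; omega
  rw [h4, Int.norm_eq_abs, abs_of_nonneg (by exact_mod_cast h2)]
  exact_mod_cast h3.le

/-- Displacement bound obtained by cutting time into intervals of length `n`. -/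
lemma norm_sub_le_of_local {E : Type*} [SeminormedAddCommGroup E] {x : ℕ → E} {n b : ℕ} {N : ℝ}
    (hN : 0 ≤ N) (hn : 0 < n) (k : ℕ) : ∀ a, a + k = b →
    (∀ i, a ≤ i → i < b → ∀ j, i ≤ j → j ≤ b → j ≤ i + n → ‖x j - x i‖ ≤ N) →
    ‖x b - x a‖ ≤ N * ((k : ℝ) / n + 1) := by
  induction k using Nat.strong_induction_on with
  | _ k ih =>
    intro a hab h
    have hn' : (0 : ℝ) < n := by exact_mod_cast hn
    rcases Nat.eq_zero_or_pos k with rfl | hk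
    · obtain rfl : a = b := by omega
      simp [hN]
    by_cases hkn : k ≤ n
    · have := h a le_rfl (by omega) b (by omega) le_rfl (by omega)
      have h2 : 0 ≤ N * ((k : ℝ) / n) := by positivity
      linarith
    · have h1 := h a le_rfl (by omega) (a + n) (by omega) (by omega) le_rfl
      have h2 := ih (k - n) (by omega) (a + n) (by omega)
        fun i hi hib j => h i (by omega) hib j
      have h3 : ‖x b - x a‖ ≤ ‖x b - x (a + n)‖ + ‖x (a + n) - x a‖ :=
        norm_sub_le_norm_sub_add_norm_sub _ _ _
      have h4 : ((k - n : ℕ) : ℝ) / n = (k : ℝ) / n - 1 := by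
        rw [Nat.cast_sub (by omega), sub_div, div_self hn'.ne']
      rw [h4] at h2
      linarith

/-- At the first time the walk is `N` away from its start, the last step is shorter than `N`, so the
walk has stayed within `2N` of its start and within `3N` of `c`. This would be a fast crossing at
`c`, which explains the radius `3N` in that definition. -/
lemma norm_sub_lt_of_not_hasFastCrossing {d : ℕ} {G : SimpleGraph (Fin d → ℤ)}
    {v c : Fin d → ℤ} {r : ℝ} {N n : ℕ} (hN : 0 < N) (hlong : ¬ HasLongEdge G v r N)
    (hc : ¬ HasFastCrossing G c N n) {x : ℕ → Fin d → ℤ} {l : ℕ} (hx : IsWalkInBall G v r x l)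
    (hx0 : ‖x 0 - c‖ ≤ N) (hl : l ≤ n) : ‖x l - x 0‖ < N := by
  have hN' : (0 : ℝ) < N := by exact_mod_cast hN
  induction l using Nat.strong_induction_on with
  | _ l ih =>
    by_contra! hfar
    have hlt : ∀ i < l, ‖x i - x 0‖ < N := fun i hi =>
      ih i hi ⟨fun j hj => hx.1 j (by omega), fun j hj => hx.2 j (by omega)⟩ (by omega)
    refine hc ⟨x, l, hl, ⟨fun i hi => ?_, hx.2⟩, hfar⟩
    have h2 : ‖x i - x 0‖ < 2 * N := by
      rcases hi.lt_or_eq with hi | rfl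
      · have := hlt i hi; linarith
      · rcases Nat.eq_zero_or_pos i with rfl | hi0
        · simpa using hN
        · obtain ⟨m, rfl⟩ : ∃ m, i = m + 1 := ⟨i - 1, by omega⟩
          have h3 : ‖x m - x (m + 1)‖ < N := by
            by_contra! h
            exact hlong ⟨_, _, hx.1 m (by omega), hx.1 _ le_rfl, hx.2 m (by omega), h⟩
          have h4 := hlt m (by omega)
          have h5 := norm_sub_le_norm_sub_add_norm_sub (x (m + 1)) (x m) (x 0)
          rw [norm_sub_rev] at h3
          linarith
    have := norm_sub_le_norm_sub_add_norm_sub (x i) (x 0) c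
    linarith

/-- In a regular box, a walk of `l` steps covers a distance at most `N (l / n + 17)`. -/
lemma norm_sub_le_of_not_isIrregular {d : ℕ} {G : SimpleGraph (Fin d → ℤ)}
    {v : Fin d → ℤ} {R N n : ℕ} (hN : 0 < N) (hn : 0 < n) (hirr : ¬ IsIrregular G v R N n)
    {x : ℕ → Fin d → ℤ} {l : ℕ} (hx : IsWalkInBall G v (3 * (R * N)) x l) :
    ‖x l - x 0‖ ≤ N * ((l : ℝ) / n + 17) := by
  have hN' : (0 : ℝ) < N := by exact_mod_cast hN
  have hn' : (0 : ℝ) < n := by exact_mod_cast hn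
  simp only [IsIrregular, not_or] at hirr
  obtain ⟨hlong, hsep⟩ := hirr
  -- Without separated crossings, any one grid point with a fast crossing serves as centre for all
  -- of them; if there is none, `u` is arbitrary.
  obtain ⟨u, hu⟩ : ∃ u : Fin d → ℤ, ∀ z : Fin d → ℤ,
      ‖(N : ℤ) • z - v‖ ≤ (3 * R + 1) * N → HasFastCrossing G ((N : ℤ) • z) N n →
      ‖(N : ℤ) • z - u‖ ≤ 6 * N := by
    by_cases h : ∃ z : Fin d → ℤ,
      ‖(N : ℤ) • z - v‖ ≤ (3 * R + 1) * N ∧ HasFastCrossing G ((N : ℤ) • z) N n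
    · obtain ⟨w, hw1, hw2⟩ := h
      refine ⟨(N : ℤ) • w, fun z hz1 hz2 => ?_⟩
      by_contra! hlt
      exact hsep ⟨z, w, hz1, hw1, hlt, hz2, hw2⟩
    · push Not at h
      exact ⟨0, fun z h1 h2 => absurd h2 (h z h1)⟩
  -- A grid point within `N` of `x i` is then more than `6N` from `u`, so it has no fast crossing.
  have hloc : ∀ i, 7 * (N : ℝ) < ‖x i - u‖ → ∀ j, i ≤ j → j ≤ l → j ≤ i + n →
      ‖x j - x i‖ ≤ N := by
    intro i hi j hij hjl hjn
    obtain ⟨z, hz⟩ := exists_smul_near (x i) hN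
    have h1 : ‖(N : ℤ) • z - v‖ ≤ (3 * R + 1) * N := by
      have h2 := norm_sub_le_norm_sub_add_norm_sub ((N : ℤ) • z) (x i) v
      have h3 := hx.1 i (by omega)
      rw [norm_sub_rev] at hz
      linarith
    have h4 : ¬ HasFastCrossing G ((N : ℤ) • z) N n := fun h => by
      have h5 := hu z h1 h
      have h6 := norm_sub_le_norm_sub_add_norm_sub (x i) ((N : ℤ) • z) u
      linarith
    have h7 := norm_sub_lt_of_not_hasFastCrossing hN hlong h4
      (hx.shift i (m := j - i) (by omega)) hz (by omega)
    rw [show i + (j - i) = j by omega] at h7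
    exact h7.le
  -- Cut at the first and last visits to the ball of radius `7N` around `u`. The additive constant
  -- is 1 before, 14 for the diameter, and 2 after: one for the edge leaving the ball, one for
  -- rounding.
  by_cases hzone : ∃ i, i ≤ l ∧ ‖x i - u‖ ≤ 7 * N
  · classical
    set s : Finset ℕ := (Finset.range (l + 1)).filter fun i => ‖x i - u‖ ≤ 7 * N with hs
    have hmem : ∀ i, i ∈ s ↔ i ≤ l ∧ ‖x i - u‖ ≤ 7 * N := by simp [hs]
    have hne : s.Nonempty := by
      obtain ⟨i, hi⟩ := hzone
      exact ⟨i, (hmem i).2 hi⟩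
    obtain ⟨ha1, ha2⟩ := (hmem _).1 (s.min'_mem hne)
    obtain ⟨hb1, hb2⟩ := (hmem _).1 (s.max'_mem hne)
    have hamin : ∀ i < s.min' hne, 7 * (N : ℝ) < ‖x i - u‖ := fun i hi => by
      by_contra! h
      exact absurd (s.min'_le i ((hmem i).2 ⟨by omega, h⟩)) (by omega)
    have hbmax : ∀ i ≤ l, s.max' hne < i → 7 * (N : ℝ) < ‖x i - u‖ := fun i hil hi => by
      by_contra! h
      exact absurd (s.le_max' i ((hmem i).2 ⟨hil, h⟩)) (by omega)
    have hab := s.min'_le_max' hne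
    set a := s.min' hne
    set b := s.max' hne
    have hfirst : ‖x a - x 0‖ ≤ N * ((a : ℝ) / n + 1) :=
      norm_sub_le_of_local hN'.le hn a 0 (by omega)
        fun i _ hi j hij hja => hloc i (hamin i hi) j hij (by omega)
    have hmid : ‖x b - x a‖ ≤ 14 * N := by
      have := norm_sub_le_norm_sub_add_norm_sub (x b) u (x a)
      rw [norm_sub_rev u] at this
      linarith
    have hlast : ‖x l - x b‖ ≤ N * (((l - b : ℕ) : ℝ) / n + 2) := by
      rcases hb1.eq_or_lt with hbl | hbl
      · rw [hbl]; simp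
      · have h1 : ‖x l - x (b + 1)‖ ≤ N * (((l - (b + 1) : ℕ) : ℝ) / n + 1) :=
          norm_sub_le_of_local hN'.le hn _ (b + 1) (by omega)
            fun i hi hil j hij hja => hloc i (hbmax i (by omega) (by omega)) j hij (by omega)
        have h2 : ‖x b - x (b + 1)‖ < N := by
          by_contra! h
          exact hlong ⟨_, _, hx.1 b (by omega), hx.1 _ (by omega), hx.2 b (by omega), h⟩
        rw [norm_sub_rev] at h2
        have h3 := norm_sub_le_norm_sub_add_norm_sub (x l) (x (b + 1)) (x b)
        have h4 : ((l - (b + 1) : ℕ) : ℝ) / n ≤ ((l - b : ℕ) : ℝ) / n := by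
          gcongr; omega
        nlinarith
    have h1 := norm_sub_le_norm_sub_add_norm_sub (x l) (x b) (x 0)
    have h2 := norm_sub_le_norm_sub_add_norm_sub (x b) (x a) (x 0)
    have h3 : (a : ℝ) / n + ((l - b : ℕ) : ℝ) / n ≤ (l : ℝ) / n := by
      rw [← add_div]
      gcongr
      rw [← Nat.cast_add]
      exact_mod_cast (by omega : a + (l - b) ≤ l)
    nlinarith
  · push Not at hzone
    have := norm_sub_le_of_local (x := x) (b := l) hN'.le hn l 0 (by omega)
        fun i _ hi j hij hjl => hloc i (hzone i (by omega)) j hij hjl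
    nlinarith

/-- In a regular box, `n (R - 18)` steps cover at most `N (R - 18 + 17) < R N`; the eighteenth unit
makes the inequality strict. -/
lemma HasFastCrossing.isIrregular {d : ℕ} {G : SimpleGraph (Fin d → ℤ)}
    {v : Fin d → ℤ} {R N n : ℕ} (hN : 0 < N) (hn : 0 < n) (hR : 18 ≤ R)
    (h : HasFastCrossing G v (R * N) (n * (R - 18))) : IsIrregular G v R N n := by
  by_contra hirr
  obtain ⟨x, l, hl, hx, hfar⟩ := h
  have hN' : (0 : ℝ) < N := by exact_mod_cast hN
  have hn' : (0 : ℝ) < n := by exact_mod_cast hn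
  have h1 := norm_sub_le_of_not_isIrregular hN hn hirr (x := x) (l := l) (by simpa using hx)
  have h2 : (l : ℝ) / n ≤ R - 18 := by
    rw [div_le_iff₀ hn', mul_comm]
    have : (l : ℝ) ≤ ((n * (R - 18) : ℕ) : ℝ) := by exact_mod_cast hl
    rwa [Nat.cast_mul, Nat.cast_sub hR] at this
  push_cast at hfar
  nlinarith

/-- This starts the induction over scales, where the time is 1. -/
lemma HasFastCrossing.hasLongEdge {d : ℕ} {G : SimpleGraph (Fin d → ℤ)}
    {v : Fin d → ℤ} {N : ℕ} (hN : 0 < N) (h : HasFastCrossing G v N 1) :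
    HasLongEdge G v (3 * N) N := by
  obtain ⟨x, l, hl, hx, hfar⟩ := h
  interval_cases l
  · simp at hfar; omega
  · exact ⟨_, _, hx.1 0 (by simp), hx.1 1 le_rfl, hx.2 0 one_pos, by rwa [norm_sub_rev]⟩

lemma HasFastCrossing.congr {d : ℕ} {G H : SimpleGraph (Fin d → ℤ)} {v : Fin d → ℤ} {N n : ℕ}
    (hGH : ∀ x y, ‖x - v‖ ≤ 3 * N → ‖y - v‖ ≤ 3 * N → G.Adj x y → H.Adj x y)
    (h : HasFastCrossing G v N n) : HasFastCrossing H v N n := by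
  obtain ⟨x, l, hl, hx, hfar⟩ := h
  exact ⟨x, l, hl, ⟨hx.1, fun i hi => hGH _ _ (hx.1 i hi.le) (hx.1 _ hi) (hx.2 i hi)⟩, hfar⟩

/-! ### Probabilities of fast crossings and irregular boxes -/

/-- The sup-norm ball of radius `m` around `v`, as a finite set. -/
noncomputable def latticeBox {d : ℕ} (v : Fin d → ℤ) (m : ℕ) : Finset (Fin d → ℤ) :=
  Finset.Icc (fun i => v i - m) (fun i => v i + m)

lemma mem_latticeBox {d : ℕ} {v x : Fin d → ℤ} {m : ℕ} :
    x ∈ latticeBox v m ↔ ‖x - v‖ ≤ m := by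
  rw [latticeBox, Finset.mem_Icc, pi_norm_le_iff_of_nonneg (by positivity), Pi.le_def, Pi.le_def,
    ← forall_and]
  refine forall_congr' fun i => ?_
  rw [Pi.sub_apply, Int.norm_eq_abs]
  constructor
  · rintro ⟨h1, h2⟩
    exact_mod_cast abs_le.2 ⟨by linarith, by linarith⟩
  · intro h
    have h' : |x i - v i| ≤ (m : ℤ) := by exact_mod_cast h
    rw [abs_le] at h'
    exact ⟨by linarith, by linarith⟩

lemma card_latticeBox {d : ℕ} (v : Fin d → ℤ) (m : ℕ) :
    (latticeBox v m).card = (2 * m + 1) ^ d := by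
  rw [latticeBox, Pi.card_Icc, Finset.prod_congr rfl (g := fun _ => 2 * m + 1)]
  · simp
  · intro i _
    rw [Int.card_Icc]
    omega

/-- The bonds with both endpoints in `latticeBox v m`. -/
noncomputable def latticeBonds {d : ℕ} (v : Fin d → ℤ) (m : ℕ) :
    Finset {e : Sym2 (Fin d → ℤ) // ¬ e.IsDiag} := by
  classical
  exact ((latticeBox v m ×ˢ latticeBox v m).image fun q => s(q.1, q.2)).subtype _

lemma mem_latticeBonds {d : ℕ} {v : Fin d → ℤ} {m : ℕ}
    {e : {e : Sym2 (Fin d → ℤ) // ¬ e.IsDiag}} :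
    e ∈ latticeBonds v m ↔ ∃ x y, ‖x - v‖ ≤ m ∧ ‖y - v‖ ≤ m ∧ s(x, y) = e.1 := by
  classical
  simp [latticeBonds, mem_latticeBox, and_assoc]

lemma disjoint_latticeBonds {d : ℕ} {v w : Fin d → ℤ} {m : ℕ} (h : 2 * (m : ℝ) < ‖v - w‖) :
    Disjoint (latticeBonds v m) (latticeBonds w m) := by
  rw [Finset.disjoint_left]
  intro e he he'
  obtain ⟨x, y, hx, hy, hxy⟩ := mem_latticeBonds.1 he
  obtain ⟨x', y', hx', hy', hxy'⟩ := mem_latticeBonds.1 he'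
  have key : ∀ z : Fin d → ℤ, ‖z - v‖ ≤ m → ‖z - w‖ ≤ m → False := fun z h1 h2 => by
    have := norm_sub_le_norm_sub_add_norm_sub v z w
    rw [norm_sub_rev] at h1
    linarith
  rw [← hxy, Sym2.eq_iff] at hxy'
  rcases hxy' with ⟨rfl, rfl⟩ | ⟨rfl, rfl⟩
  · exact key _ hx hx'
  · exact key _ hy hx'

section Percolation

variable {d : ℕ} {Ω : Type*} [MeasurableSpace Ω] {μ : Measure Ω}
  {p : (Fin d → ℤ) → ℝ} {ω : Sym2 (Fin d → ℤ) → Ω → Bool}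

lemma openGraph_adj {Ω : Type*} {ω : Sym2 (Fin d → ℤ) → Ω → Bool} {a : Ω} {x y : Fin d → ℤ} :
    (openGraph ω a).Adj x y ↔ ω s(x, y) a = true ∧ x ≠ y := by
  simp [openGraph]

/-- Only the finitely many bonds inside the ball matter, so independence of disjoint bond families
applies and measurability is automatic. -/
lemma exists_preimage_hasFastCrossing {Ω : Type*} (ω : Sym2 (Fin d → ℤ) → Ω → Bool) (v : Fin d → ℤ)
    (N n : ℕ) :
    ∃ s : Set (latticeBonds v (3 * N) → Bool), {a | HasFastCrossing (openGraph ω a) v N n} =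
      (fun a (i : latticeBonds v (3 * N)) => ω i.1.1 a) ⁻¹' s := by
  refine ⟨{g | HasFastCrossing (SimpleGraph.fromEdgeSet {e | ∃ (h : ¬ e.IsDiag)
    (h' : ⟨e, h⟩ ∈ latticeBonds v (3 * N)), g ⟨⟨e, h⟩, h'⟩ = true}) v N n}, ?_⟩
  ext a
  simp only [Set.mem_ofPred_eq, Set.mem_preimage]
  constructor <;> refine HasFastCrossing.congr fun x y hx hy hxy => ?_
  · rw [openGraph_adj] at hxy
    rw [SimpleGraph.fromEdgeSet_adj]
    exact ⟨⟨by simpa using hxy.2, mem_latticeBonds.2 ⟨x, y, by simpa using hx, by simpa using hy,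
      rfl⟩, hxy.1⟩, hxy.2⟩
  · rw [SimpleGraph.fromEdgeSet_adj] at hxy
    obtain ⟨⟨h, h', hg⟩, hne⟩ := hxy
    exact openGraph_adj.2 ⟨hg, hne⟩

lemma IsLongRangePercolation.measureReal_two_crossings (hω : IsLongRangePercolation μ p ω)
    {v w : Fin d → ℤ} {N : ℕ} (h : 6 * (N : ℝ) < ‖v - w‖) (n : ℕ) :
    μ.real {a | HasFastCrossing (openGraph ω a) v N n ∧ HasFastCrossing (openGraph ω a) w N n} =
      μ.real {a | HasFastCrossing (openGraph ω a) v N n} *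
        μ.real {a | HasFastCrossing (openGraph ω a) w N n} := by
  obtain ⟨s, hs⟩ := exists_preimage_hasFastCrossing ω v N n
  obtain ⟨t, ht⟩ := exists_preimage_hasFastCrossing ω w N n
  have hind := iIndepFun.indepFun_finset (latticeBonds v (3 * N)) (latticeBonds w (3 * N))
    (disjoint_latticeBonds (by push_cast; linarith)) hω.indep fun e => hω.measurable e.1 e.2
  rw [Set.ofPred_and, hs, ht, measureReal_def,
    hind.measure_inter_preimage_eq_mul s t (Set.toFinite s).measurableSet
      (Set.toFinite t).measurableSet, ENNReal.toReal_mul]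
  rfl

variable [IsProbabilityMeasure μ]

lemma IsLongRangePercolation.measureReal_hasLongEdge_le (hω : IsLongRangePercolation μ p ω)
    {b : ℝ} (hb : 0 ≤ b) {N : ℕ} (hN : 0 < N) (hp : ∀ k : Fin d → ℤ, (N : ℝ) ≤ ‖k‖ → p k ≤ b)
    (v : Fin d → ℤ) (r : ℕ) :
    μ.real {a | HasLongEdge (openGraph ω a) v r N} ≤ ((2 * r + 1 : ℕ) : ℝ) ^ (2 * d) * b := by
  have hsub : {a | HasLongEdge (openGraph ω a) v r N} ⊆
      ⋃ q ∈ latticeBox v r ×ˢ latticeBox v r,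
        {a | (openGraph ω a).Adj q.1 q.2 ∧ (N : ℝ) ≤ ‖q.1 - q.2‖} := by
    rintro a ⟨x, y, hx, hy, h⟩
    simp only [Set.mem_iUnion]
    exact ⟨(x, y), Finset.mem_product.2 ⟨mem_latticeBox.2 hx, mem_latticeBox.2 hy⟩, h⟩
  refine (measureReal_mono hsub (measure_ne_top _ _)).trans ((measureReal_biUnion_finset_le _ _).trans ?_)
  have hterm : ∀ q ∈ latticeBox v r ×ˢ latticeBox v r,
      μ.real {a | (openGraph ω a).Adj q.1 q.2 ∧ (N : ℝ) ≤ ‖q.1 - q.2‖} ≤ b := by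
    intro q _
    by_cases hq : (N : ℝ) ≤ ‖q.1 - q.2‖
    · have hne : q.1 ≠ q.2 := fun h => by
        rw [h, sub_self, norm_zero] at hq
        exact absurd (by exact_mod_cast hq : N ≤ 0) (by omega)
      have hle : μ.real {a | ω s(q.1, q.2) a = true} ≤ b := by
        rw [measureReal_def, hω.prob_open _ _ hne]
        exact ENNReal.toReal_le_of_le_ofReal hb (ENNReal.ofReal_le_ofReal (hp _ hq))
      exact (measureReal_mono fun a ha => (openGraph_adj.1 ha.1).1).trans hle
    · simpa [hq] using hb
  refine (Finset.sum_le_card_nsmul _ _ _ hterm).trans (le_of_eq ?_)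
  rw [Finset.card_product, card_latticeBox, nsmul_eq_mul]
  push_cast
  ring

lemma IsLongRangePercolation.measureReal_hasSeparatedCrossings_le
    (hω : IsLongRangePercolation μ p ω) {q : ℝ} {N n : ℕ} (hN : 0 < N)
    (hq : ∀ v, μ.real {a | HasFastCrossing (openGraph ω a) v N n} ≤ q) (v : Fin d → ℤ) (R : ℕ) :
    μ.real {a | HasSeparatedCrossings (openGraph ω a) v ((3 * R + 1) * N) N n} ≤
      ((6 * R + 5 : ℕ) : ℝ) ^ (2 * d) * q ^ 2 := by
  obtain ⟨c, hc⟩ := exists_smul_near v hN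
  have hN' : (0 : ℝ) < N := by exact_mod_cast hN
  have hq0 : 0 ≤ q := measureReal_nonneg.trans (hq v)
  -- In units of `N`, the radius is `3R + 1` plus 1 for replacing `v` by the grid point `c`.
  have hmem : ∀ z : Fin d → ℤ, ‖(N : ℤ) • z - v‖ ≤ (3 * R + 1) * N →
      z ∈ latticeBox c (3 * R + 2) := by
    intro z hz
    have h1 := norm_sub_le_norm_sub_add_norm_sub ((N : ℤ) • z) v ((N : ℤ) • c)
    rw [← smul_sub, norm_smul, Int.norm_natCast] at h1
    rw [mem_latticeBox]
    push_cast
    refine le_of_mul_le_mul_left (a := (N : ℝ)) ?_ hN'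
    nlinarith
  have hsub : {a | HasSeparatedCrossings (openGraph ω a) v ((3 * R + 1) * N) N n} ⊆
      ⋃ i ∈ latticeBox c (3 * R + 2) ×ˢ latticeBox c (3 * R + 2),
        {a | 6 * (N : ℝ) < ‖(N : ℤ) • i.1 - (N : ℤ) • i.2‖ ∧
          HasFastCrossing (openGraph ω a) ((N : ℤ) • i.1) N n ∧
          HasFastCrossing (openGraph ω a) ((N : ℤ) • i.2) N n} := by
    rintro a ⟨z, w, hz, hw, h⟩
    simp only [Set.mem_iUnion]
    exact ⟨(z, w), Finset.mem_product.2 ⟨hmem z hz, hmem w hw⟩, h⟩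
  refine (measureReal_mono hsub (measure_ne_top _ _)).trans ((measureReal_biUnion_finset_le _ _).trans ?_)
  refine (Finset.sum_le_card_nsmul _ _ (q ^ 2) fun i _ => ?_).trans (le_of_eq ?_)
  · by_cases hi : 6 * (N : ℝ) < ‖(N : ℤ) • i.1 - (N : ℤ) • i.2‖
    · simp only [hi, true_and]
      rw [hω.measureReal_two_crossings hi, sq]
      exact mul_le_mul (hq _) (hq _) measureReal_nonneg hq0
    · simp only [hi, false_and, Set.ofPred_false, measureReal_empty]
      positivity
  · rw [Finset.card_product, card_latticeBox, nsmul_eq_mul]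
    push_cast
    ring

lemma IsLongRangePercolation.measureReal_isIrregular_le
    (hω : IsLongRangePercolation μ p ω) {b q : ℝ} {N n R : ℕ} (hN : 0 < N) (hR : 2 ≤ R)
    (hb : 0 ≤ b) (hp : ∀ k : Fin d → ℤ, (N : ℝ) ≤ ‖k‖ → p k ≤ b)
    (hq : ∀ v, μ.real {a | HasFastCrossing (openGraph ω a) v N n} ≤ q) (v : Fin d → ℤ) :
    μ.real {a | IsIrregular (openGraph ω a) v R N n} ≤
      (9 * R : ℝ) ^ (2 * d) * (q ^ 2 + (N : ℝ) ^ (2 * d) * b) := by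
  have h1 := hω.measureReal_hasLongEdge_le hb hN hp v (3 * (R * N))
  have h2 := hω.measureReal_hasSeparatedCrossings_le hN hq v R
  have h3 : (((2 * (3 * (R * N)) + 1 : ℕ) : ℝ)) ≤ 9 * R * N := by
    have : 1 ≤ R * N := Nat.mul_pos (by omega) hN
    exact_mod_cast (by nlinarith : 2 * (3 * (R * N)) + 1 ≤ 9 * R * N)
  have h4 : ((6 * R + 5 : ℕ) : ℝ) ≤ 9 * R := by
    exact_mod_cast (by omega : 6 * R + 5 ≤ 9 * R)
  have h5 : (((2 * (3 * (R * N)) + 1 : ℕ) : ℝ)) ^ (2 * d) * b ≤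
      (9 * R : ℝ) ^ (2 * d) * ((N : ℝ) ^ (2 * d) * b) := by
    rw [← mul_assoc ((9 * R : ℝ) ^ (2 * d)), ← mul_pow]
    exact mul_le_mul_of_nonneg_right (pow_le_pow_left₀ (by positivity) h3 _) hb
  have h6 : ((6 * R + 5 : ℕ) : ℝ) ^ (2 * d) * q ^ 2 ≤ (9 * R : ℝ) ^ (2 * d) * q ^ 2 := by
    gcongr
  have h7 := measureReal_union_le (μ := μ)
    {a | HasLongEdge (openGraph ω a) v ((3 * (R * N) : ℕ) : ℝ) N}
    {a | HasSeparatedCrossings (openGraph ω a) v ((3 * R + 1) * N) N n}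
  have h8 : {a | IsIrregular (openGraph ω a) v R N n} =
    {a | HasLongEdge (openGraph ω a) v ((3 * (R * N) : ℕ) : ℝ) N} ∪
    {a | HasSeparatedCrossings (openGraph ω a) v ((3 * R + 1) * N) N n} := by
    ext a
    simp [IsIrregular]
  rw [h8]
  linarith

end Percolation

/-! ### The sequence of scales -/

/-- The length scales: consecutive ratios are `2 ^ k, 2 ^ (k + 1), …`. -/
def scaleLength (k N : ℕ) : ℕ → ℕ
  | 0 => N
  | j + 1 => 2 ^ (k + j) * scaleLength k N j

/-- The time scales matching `scaleLength`. -/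
def scaleTime (k : ℕ) : ℕ → ℕ
  | 0 => 1
  | j + 1 => scaleTime k j * (2 ^ (k + j) - 18)

lemma le_two_pow_of_le {k : ℕ} (hk : 7 ≤ k) : 128 ≤ 2 ^ k :=
  (by norm_num : 128 = 2 ^ 7) ▸ Nat.pow_le_pow_right (by norm_num) hk

lemma scaleLength_pos {k N : ℕ} (hN : 0 < N) (j : ℕ) : 0 < scaleLength k N j := by
  induction j with
  | zero => exact hN
  | succ j ih => exact Nat.mul_pos (by positivity) ih

lemma scaleTime_pos {k : ℕ} (hk : 7 ≤ k) (j : ℕ) : 0 < scaleTime k j := by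
  induction j with
  | zero => exact one_pos
  | succ j ih =>
    have := le_two_pow_of_le (k := k + j) (by omega)
    exact Nat.mul_pos ih (by omega)

lemma scaleLength_mono (k N : ℕ) : Monotone (scaleLength k N) :=
  monotone_nat_of_le_succ fun _ => Nat.le_mul_of_pos_left _ (by positivity)

lemma lt_scaleLength {k N : ℕ} (hk : 1 ≤ k) (hN : 0 < N) (j : ℕ) : j < scaleLength k N j := by
  induction j with
  | zero => exact hN
  | succ j ih =>
    have : 2 ^ 1 ≤ 2 ^ (k + j) := Nat.pow_le_pow_right (by norm_num) (by omega)
    simp only [scaleLength]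
    nlinarith

lemma le_scaleLength {k N : ℕ} (j : ℕ) : N ≤ scaleLength k N j :=
  scaleLength_mono k N (Nat.zero_le j)

/-- The speed `scaleLength / scaleTime` stays bounded along the scales. -/
lemma scaleLength_le_scaleTime {k : ℕ} (hk : 7 ≤ k) (N j : ℕ) :
    (scaleLength k N j : ℝ) ≤ 2 * N * scaleTime k j := by
  have hT : ∀ j, (128 : ℝ) ≤ 2 ^ (k + j) := fun j => by
    exact_mod_cast le_two_pow_of_le (k := k + j) (by omega)
  -- The term `36 / 2 ^ (k + j)` is a reserve that halves at each scale. With `T = 2 ^ (k + j)`, the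
  -- released half contributes `18`, which covers the loss `18 (1 / 2 + 36 / T)` from replacing `T`
  -- by `T - 18`, since `T ≥ 72`.
  suffices h : (scaleLength k N j : ℝ) * (1 / 2 + 36 / 2 ^ (k + j)) ≤ N * scaleTime k j by
    have h1 : (0 : ℝ) ≤ scaleLength k N j * (36 / 2 ^ (k + j)) := by positivity
    linarith
  induction j with
  | zero =>
    have h1 : (36 : ℝ) / 2 ^ (k + 0) ≤ 1 / 2 := by
      rw [div_le_iff₀ (by positivity)]
      linarith [hT 0]
    simp only [scaleLength, scaleTime, Nat.cast_one]
    exact mul_le_mul_of_nonneg_left (by linarith) (Nat.cast_nonneg N)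
  | succ j ih =>
    have hTj := hT j
    have h18 : 18 ≤ 2 ^ (k + j) := (le_two_pow_of_le (k := k + j) (by omega)).trans' (by norm_num)
    simp only [scaleLength, scaleTime]
    rw [← add_assoc, pow_succ]
    push_cast [Nat.cast_sub h18]
    generalize (2 : ℝ) ^ (k + j) = T at *
    have h1 := mul_le_mul_of_nonneg_right ih (by linarith : (0 : ℝ) ≤ T - 18)
    have h2 : T * (1 / 2 + 36 / (T * 2)) ≤ (1 / 2 + 36 / T) * (T - 18) := by
      have : T ≠ 0 := by positivity
      have h3 : (1 / 2 + 36 / T) * (T - 18) - T * (1 / 2 + 36 / (T * 2)) = 9 - 648 / T := by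
        field_simp
        ring
      have h4 : 648 / T ≤ 9 := by
        rw [div_le_iff₀ (by positivity)]
        linarith
      linarith
    have h5 := mul_le_mul_of_nonneg_left h2 (Nat.cast_nonneg (α := ℝ) (scaleLength k N j))
    linarith

/-- For `q = R ^ (-4d)` with `R = 2 ^ k`, squaring gains `R ^ (-4d)` against the entropy factor `R ^
(2d)`. The surplus `R ^ (2d)` absorbs the constants, as `R ^ 2 ≥ 2592`. The 2 accounts for a
long-edge term no larger than `q ^ 2`. -/
lemma recursion_le {d k : ℕ} (hd : 1 ≤ d) (hk : 7 ≤ k) :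
    (9 * 2 ^ k : ℝ) ^ (2 * d) * (2 * ((2 : ℝ) ^ (4 * d * k))⁻¹ ^ 2) ≤
      ((2 : ℝ) ^ (4 * d * (k + 1)))⁻¹ := by
  have hT : (128 : ℝ) ≤ 2 ^ k := by exact_mod_cast le_two_pow_of_le hk
  have e1 : (2 : ℝ) ^ (4 * d * k) = (((2 : ℝ) ^ k) ^ 4) ^ d := by
    rw [← pow_mul, ← pow_mul]; ring_nf
  have e2 : (2 : ℝ) ^ (4 * d * (k + 1)) = (((2 : ℝ) ^ k) ^ 4) ^ d * 16 ^ d := by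
    rw [mul_add, pow_add, e1, mul_one, pow_mul]; norm_num
  rw [e1, e2]
  generalize (2 : ℝ) ^ k = T at *
  have hT0 : 0 < T := by linarith
  have h1 : (2 : ℝ) * 1296 ^ d ≤ (T ^ 2) ^ d := calc
    (2 : ℝ) * 1296 ^ d ≤ 2 ^ d * 1296 ^ d := by
      gcongr
      exact le_self_pow₀ (by norm_num) (by omega)
    _ = 2592 ^ d := by rw [← mul_pow]; norm_num
    _ ≤ (T ^ 2) ^ d := by gcongr; nlinarith
  have e3 : (9 * T) ^ (2 * d) * (2 * ((T ^ 4) ^ d)⁻¹ ^ 2) =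
      (2 * 1296 ^ d) * ((T ^ 2) ^ d)⁻¹ * ((T ^ 4) ^ d * 16 ^ d)⁻¹ := by
    have e4 : (9 * T) ^ (2 * d) = 81 ^ d * (T ^ 2) ^ d := by
      rw [pow_mul, ← mul_pow]; ring
    have e5 : (1296 : ℝ) ^ d = 81 ^ d * 16 ^ d := by rw [← mul_pow]; norm_num
    have e6 : (T ^ 4) ^ d = (T ^ 2) ^ d * (T ^ 2) ^ d := by rw [← mul_pow]; ring
    rw [e4, e5, e6]
    field_simp
  rw [e3]
  refine mul_le_of_le_one_left (by positivity) ?_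
  rw [← div_eq_mul_inv]
  exact div_le_one_of_le₀ h1 (by positivity)

/-- This keeps the long-edge term below `q ^ 2` at every scale: `k η ≥ 8d` makes it shrink by at
least `2 ^ (8d)` per scale, exactly the rate of `q ^ 2`. -/
lemma scaleLength_rpow_le {d k N : ℕ} {C η : ℝ} (hC : 0 ≤ C)
    (hkη : 8 * d ≤ k * η) (hη : 0 < η)
    (h0 : C * (N : ℝ) ^ (-η) ≤ ((2 : ℝ) ^ (4 * d * k))⁻¹ ^ 2) (j : ℕ) :
    C * (scaleLength k N j : ℝ) ^ (-η) ≤ ((2 : ℝ) ^ (4 * d * (k + j)))⁻¹ ^ 2 := by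
  induction j with
  | zero => exact h0
  | succ j ih =>
    have h1 : ((2 : ℝ) ^ (k + j)) ^ (-η) ≤ ((2 : ℝ) ^ (8 * d))⁻¹ := by
      rw [← Real.rpow_natCast, ← Real.rpow_natCast, ← Real.rpow_mul (by norm_num),
        ← Real.rpow_neg (by norm_num)]
      refine Real.rpow_le_rpow_of_exponent_le (by norm_num) ?_
      push_cast
      have : 0 ≤ (j : ℝ) * η := by positivity
      linarith
    have e1 : ((2 : ℝ) ^ (4 * d * (k + (j + 1))))⁻¹ ^ 2 =
        ((2 : ℝ) ^ (8 * d))⁻¹ * ((2 : ℝ) ^ (4 * d * (k + j)))⁻¹ ^ 2 := by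
      rw [inv_pow, inv_pow, ← mul_inv, ← pow_mul, ← pow_mul, ← pow_add]
      ring_nf
    rw [e1]
    simp only [scaleLength, Nat.cast_mul, Nat.cast_pow, Nat.cast_ofNat]
    rw [Real.mul_rpow (by positivity) (by positivity), mul_left_comm]
    exact mul_le_mul h1 ih (by positivity) (by positivity)

/-! ### Induction over scales and Borel–Cantelli -/

section Percolation

variable {d : ℕ} {Ω : Type*} [MeasurableSpace Ω] {μ : Measure Ω} [IsProbabilityMeasure μ]
  {p : (Fin d → ℤ) → ℝ} {ω : Sym2 (Fin d → ℤ) → Ω → Bool}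

lemma IsLongRangePercolation.exists_scales (hω : IsLongRangePercolation μ p ω) (hd : 1 ≤ d)
    {s : ℝ} (hs : 2 * (d : ℝ) < s) {C B : ℝ} (hC : 0 ≤ C)
    (hp : ∀ k : Fin d → ℤ, B ≤ ‖k‖ → p k ≤ C * ‖k‖ ^ (-s)) :
    ∃ k N : ℕ, 7 ≤ k ∧ 0 < N ∧ ∀ j, μ.real {a | IsIrregular (openGraph ω a) 0 (2 ^ (k + j))
      (scaleLength k N j) (scaleTime k j)} ≤ (1 / 2) ^ j := by
  obtain ⟨η, hη, rfl⟩ : ∃ η : ℝ, 0 < η ∧ s = η + (2 * d : ℕ) :=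
    ⟨s - 2 * d, by linarith, by push_cast; ring⟩
  obtain ⟨k, hk7, hkη⟩ : ∃ k : ℕ, 7 ≤ k ∧ 8 * (d : ℝ) ≤ k * η := by
    obtain ⟨k, hk⟩ := exists_nat_ge (8 * (d : ℝ) / η)
    refine ⟨max 7 k, le_max_left _ _, ?_⟩
    rw [div_le_iff₀ hη] at hk
    refine hk.trans ?_
    gcongr
    exact le_max_right _ _
  -- The first scale is chosen after `k`. The factor `49 ^ d` pays for the entropy `(6N + 1) ^ (2d)
  -- ≤ 49 ^ d N ^ (2d)` of the initial scale.
  obtain ⟨N, hN, hBN, hCN⟩ : ∃ N : ℕ, 0 < N ∧ B ≤ N ∧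
      C * (N : ℝ) ^ (-η) ≤ ((2 : ℝ) ^ (4 * d * k))⁻¹ ^ 2 * ((49 : ℝ) ^ d)⁻¹ := by
    have h1 : Tendsto (fun N : ℕ => C * (N : ℝ) ^ (-η)) atTop (𝓝 0) := by
      simpa using ((tendsto_rpow_neg_atTop hη).comp tendsto_natCast_atTop_atTop).const_mul C
    have h2 := h1.eventually_le_const
      (show (0 : ℝ) < ((2 : ℝ) ^ (4 * d * k))⁻¹ ^ 2 * ((49 : ℝ) ^ d)⁻¹ by positivity)
    have h3 := tendsto_natCast_atTop_atTop.eventually_ge_atTop B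
    exact ((eventually_gt_atTop 0).and (h3.and h2)).exists
  have hpow : ∀ n : ℕ, 0 < n → (n : ℝ) ^ (2 * d) * (C * (n : ℝ) ^ (-(η + (2 * d : ℕ)))) =
      C * (n : ℝ) ^ (-η) := fun n hn => by
    have hn' : (0 : ℝ) < n := by exact_mod_cast hn
    rw [← Real.rpow_natCast (n : ℝ) (2 * d), mul_left_comm, ← Real.rpow_add hn']
    congr 2
    ring
  have hpn : ∀ n : ℕ, N ≤ n → ∀ x : Fin d → ℤ, (n : ℝ) ≤ ‖x‖ →
      p x ≤ C * (n : ℝ) ^ (-(η + (2 * d : ℕ))) := fun n hn x hx => by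
    have hn' : (N : ℝ) ≤ n := by exact_mod_cast hn
    have hn0 : (0 : ℝ) < n := by exact_mod_cast (by omega : 0 < n)
    refine (hp x (by linarith)).trans (mul_le_mul_of_nonneg_left ?_ hC)
    exact Real.rpow_le_rpow_of_nonpos hn0 hx (neg_nonpos.2 (by positivity))
  have h49 : ((49 : ℝ) ^ d)⁻¹ ≤ 1 := inv_le_one_of_one_le₀ (one_le_pow₀ (by norm_num))
  have hf := scaleLength_rpow_le (d := d) (k := k) (N := N) hC hkη hη
    (hCN.trans (mul_le_of_le_one_right (by positivity) h49))
  have hirr : ∀ j, (∀ v, μ.real {a | HasFastCrossing (openGraph ω a) v (scaleLength k N j)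
        (scaleTime k j)} ≤ ((2 : ℝ) ^ (4 * d * (k + j)))⁻¹) →
      ∀ v, μ.real {a | IsIrregular (openGraph ω a) v (2 ^ (k + j)) (scaleLength k N j)
        (scaleTime k j)} ≤ ((2 : ℝ) ^ (4 * d * (k + (j + 1))))⁻¹ := fun j hq v => by
    have hNj := scaleLength_pos (k := k) hN j
    have h2 : 2 ≤ 2 ^ (k + j) :=
      (le_two_pow_of_le (k := k + j) (by omega)).trans' (by norm_num)
    have h1 := hω.measureReal_isIrregular_le hNj h2 (by positivity)
      (hpn _ (le_scaleLength j)) hq v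
    rw [hpow _ hNj] at h1
    refine h1.trans (le_trans ?_ (recursion_le hd (k := k + j) (by omega)))
    push_cast
    gcongr
    linarith [hf j]
  have hq : ∀ j v, μ.real {a | HasFastCrossing (openGraph ω a) v (scaleLength k N j)
        (scaleTime k j)} ≤ ((2 : ℝ) ^ (4 * d * (k + j)))⁻¹ := by
    intro j
    induction j with
    | zero =>
      intro v
      simp only [scaleLength, scaleTime]
      have h1 : μ.real {a | HasFastCrossing (openGraph ω a) v N 1} ≤
          μ.real {a | HasLongEdge (openGraph ω a) v ((3 * N : ℕ) : ℝ) N} :=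
        measureReal_mono fun a ha => by simpa using HasFastCrossing.hasLongEdge hN ha
      have h2 := hω.measureReal_hasLongEdge_le (by positivity) hN (hpn N le_rfl) v (3 * N)
      have h3 : ((2 * (3 * N) + 1 : ℕ) : ℝ) ≤ 7 * N := by
        exact_mod_cast (by omega : 2 * (3 * N) + 1 ≤ 7 * N)
      have h4 : ((2 * (3 * N) + 1 : ℕ) : ℝ) ^ (2 * d) * (C * (N : ℝ) ^ (-(η + (2 * d : ℕ)))) ≤
          49 ^ d * (C * (N : ℝ) ^ (-η)) := by
        rw [← hpow N hN, ← mul_assoc ((49 : ℝ) ^ d)]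
        refine mul_le_mul_of_nonneg_right ?_ (by positivity)
        calc ((2 * (3 * N) + 1 : ℕ) : ℝ) ^ (2 * d) ≤ (7 * N : ℝ) ^ (2 * d) := by gcongr
          _ = 49 ^ d * (N : ℝ) ^ (2 * d) := by rw [mul_pow, pow_mul 7]; norm_num
      have h5 : (49 : ℝ) ^ d * (C * (N : ℝ) ^ (-η)) ≤ ((2 : ℝ) ^ (4 * d * k))⁻¹ ^ 2 := by
        rw [← div_eq_mul_inv, le_div_iff₀ (by positivity)] at hCN
        linarith
      have h6 : ((2 : ℝ) ^ (4 * d * k))⁻¹ ^ 2 ≤ ((2 : ℝ) ^ (4 * d * k))⁻¹ :=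
        pow_le_of_le_one (by positivity)
          (inv_le_one_of_one_le₀ (one_le_pow₀ (by norm_num))) two_ne_zero
      exact h1.trans (h2.trans (h4.trans (h5.trans h6)))
    | succ j ih =>
      intro v
      refine le_trans (measureReal_mono fun a ha => ?_) (hirr j ih v)
      exact HasFastCrossing.isIrregular (scaleLength_pos hN j) (scaleTime_pos hk7 j)
        ((le_two_pow_of_le (k := k + j) (by omega)).trans' (by norm_num)) ha
  refine ⟨k, N, hk7, hN, fun j => (hirr j (hq j) 0).trans ?_⟩
  rw [one_div, inv_pow]
  gcongr
  · norm_num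
  · nlinarith

lemma IsLongRangePercolation.ae_eventually_not_isIrregular (hω : IsLongRangePercolation μ p ω)
    (hd : 1 ≤ d) {s : ℝ} (hs : 2 * (d : ℝ) < s) {C B : ℝ} (hC : 0 ≤ C)
    (hp : ∀ k : Fin d → ℤ, B ≤ ‖k‖ → p k ≤ C * ‖k‖ ^ (-s)) :
    ∃ k N : ℕ, 7 ≤ k ∧ 0 < N ∧ ∀ᵐ a ∂μ, ∀ᶠ j in atTop,
      ¬ IsIrregular (openGraph ω a) 0 (2 ^ (k + j)) (scaleLength k N j) (scaleTime k j) := by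
  obtain ⟨k, N, hk, hN, h⟩ := hω.exists_scales hd hs hC hp
  have hsum : ∑' j, μ {a | IsIrregular (openGraph ω a) 0 (2 ^ (k + j)) (scaleLength k N j)
      (scaleTime k j)} ≠ ∞ := by
    refine ne_top_of_le_ne_top summable_geometric_two.tsum_ofReal_ne_top
      (ENNReal.tsum_le_tsum fun j => ?_)
    rw [← ofReal_measureReal]
    exact ENNReal.ofReal_le_ofReal (h j)
  exact ⟨k, N, hk, hN, ae_eventually_notMem hsum⟩

end Percolation

/-! ### From regular boxes to the chemical distance -/

/-- An edge jumping beyond `3 N_j` would be long at the last scale `m` with `‖y‖ > 3 N_m`: it lies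
in the box of radius `3 N_(m+1)` and has length more than `3 N_m - 2 N_j ≥ N_m`. Regularity at all
later scales is therefore needed. -/
lemma norm_le_of_adj {d : ℕ} {G : SimpleGraph (Fin d → ℤ)} {k N J : ℕ}
    (hk : 1 ≤ k) (hN : 0 < N)
    (hreg : ∀ j ≥ J, ¬ HasLongEdge G 0 (3 * (2 ^ (k + j) * scaleLength k N j))
      (scaleLength k N j))
    {j : ℕ} (hj : J ≤ j) {x y : Fin d → ℤ} (hxy : G.Adj x y)
    (hx : ‖x‖ ≤ 2 * scaleLength k N j) : ‖y‖ ≤ 3 * scaleLength k N j := by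
  by_contra! hy
  have hex : ∃ i, ‖y‖ ≤ 3 * scaleLength k N i := by
    obtain ⟨m, hm⟩ := exists_nat_ge ‖y‖
    have : (m : ℝ) < scaleLength k N m := by exact_mod_cast lt_scaleLength hk hN m
    exact ⟨m, by linarith⟩
  classical
  have h1 := Nat.find_spec hex
  have h2 : ∀ i < Nat.find hex, _ := fun i hi => Nat.find_min hex hi
  set i := Nat.find hex
  have hji : j < i := by
    by_contra! hij
    have : (scaleLength k N i : ℝ) ≤ scaleLength k N j := by
      exact_mod_cast scaleLength_mono k N hij
    linarith
  obtain ⟨m, hm⟩ : ∃ m, i = m + 1 := ⟨i - 1, by omega⟩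
  have h3 := h2 m (by omega)
  push Not at h3
  have h4 : (scaleLength k N j : ℝ) ≤ scaleLength k N m := by
    exact_mod_cast scaleLength_mono k N (by omega : j ≤ m)
  have h5 : ((scaleLength k N i : ℕ) : ℝ) = 2 ^ (k + m) * scaleLength k N m := by
    rw [hm]; simp [scaleLength]
  have h6 : (scaleLength k N m : ℝ) ≤ scaleLength k N i := by
    exact_mod_cast scaleLength_mono k N (by omega : m ≤ i)
  have h7 : (0 : ℝ) ≤ scaleLength k N m := Nat.cast_nonneg _
  refine hreg m (by omega) ⟨x, y, ?_, ?_, hxy, ?_⟩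
  · rw [sub_zero, ← h5]; linarith
  · rw [sub_zero, ← h5]; exact h1
  · have := norm_sub_norm_le y x
    rw [norm_sub_rev] at this
    linarith

lemma norm_le_mul_length {d : ℕ} {G : SimpleGraph (Fin d → ℤ)} {k N J : ℕ}
    (hk : 7 ≤ k) (hN : 0 < N)
    (hreg : ∀ j ≥ J, ¬ IsIrregular G 0 (2 ^ (k + j)) (scaleLength k N j) (scaleTime k j))
    {x : Fin d → ℤ} (hx : 34 * (scaleLength k N J : ℝ) ≤ ‖x‖) (w : G.Walk 0 x) :
    ‖x‖ ≤ 68 * N * w.length := by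
  classical
  obtain ⟨j, hJj, hlo, hhi⟩ : ∃ j, J ≤ j ∧ 34 * (scaleLength k N j : ℝ) ≤ ‖x‖ ∧
      ‖x‖ < 34 * scaleLength k N (j + 1) := by
    have hex : ∃ i, ‖x‖ < 34 * scaleLength k N (J + i + 1) := by
      obtain ⟨m, hm⟩ := exists_nat_ge ‖x‖
      have h1 : (m : ℝ) < scaleLength k N m := by
        exact_mod_cast lt_scaleLength (by omega) hN m
      have h2 : (scaleLength k N m : ℝ) ≤ scaleLength k N (J + m + 1) := by
        exact_mod_cast scaleLength_mono k N (by omega)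
      exact ⟨m, by linarith [norm_nonneg x]⟩
    refine ⟨J + Nat.find hex, by omega, ?_, Nat.find_spec hex⟩
    rcases Nat.eq_zero_or_pos (Nat.find hex) with h0 | h0
    · rw [h0]; exact hx
    · have := Nat.find_min hex (m := Nat.find hex - 1) (by omega)
      push Not at this
      rwa [show J + (Nat.find hex - 1) + 1 = J + Nat.find hex by omega] at this
  have hT : (128 : ℝ) ≤ 2 ^ (k + j) := by
    exact_mod_cast le_two_pow_of_le (k := k + j) (by omega)
  have hL : (0 : ℝ) < scaleLength k N j := by exact_mod_cast scaleLength_pos hN j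
  have hn : (0 : ℝ) < scaleTime k j := by exact_mod_cast scaleTime_pos hk j
  have hM : (scaleLength k N (j + 1) : ℝ) = 2 ^ (k + j) * scaleLength k N j := by
    simp [scaleLength]
  have hM' : 128 * (scaleLength k N j : ℝ) ≤ scaleLength k N (j + 1) := by
    rw [hM]; gcongr
  have hM0 : (0 : ℝ) < scaleLength k N (j + 1) := by linarith
  set M : ℝ := (scaleLength k N (j + 1) : ℝ)
  -- The walk may leave the box of radius `3M`, and `‖x‖` itself may be as large as `34M`, so it is
  -- stopped on reaching `min ‖x‖ (2M)`. The stopping jump cannot pass `3M`.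
  have hex : ∃ t, min ‖x‖ (2 * M) ≤ ‖w.getVert t‖ := ⟨w.length, by simp⟩
  have ht1 := Nat.find_spec hex
  have ht2 : ∀ i < Nat.find hex, ¬ _ := fun i hi => Nat.find_min hex hi
  have ht3 : Nat.find hex ≤ w.length := Nat.find_min' hex (by simp)
  set t := Nat.find hex
  have hbefore : ∀ i < t, ‖w.getVert i‖ ≤ 2 * M := fun i hi => by
    have := ht2 i hi
    push Not at this
    exact this.le.trans (min_le_right _ _)
  have hin : ‖w.getVert t‖ ≤ 3 * M := by
    rcases Nat.eq_zero_or_pos t with h0 | h0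
    · rw [h0, SimpleGraph.Walk.getVert_zero, norm_zero]; positivity
    · obtain ⟨m, hm⟩ : ∃ m, t = m + 1 := ⟨t - 1, by omega⟩
      have hadj := w.adj_getVert_succ (i := m) (by omega)
      rw [hm]
      refine norm_le_of_adj (J := J) (by omega) hN (fun i hi h => hreg i hi (Or.inl ?_))
        (by omega : J ≤ j + 1) hadj (hbefore m (by omega))
      push_cast
      exact h
  have hwalk : IsWalkInBall G 0 (3 * ((2 ^ (k + j) : ℕ) * scaleLength k N j)) w.getVert t := by
    refine ⟨fun i hi => ?_, fun i hi => w.adj_getVert_succ (by omega)⟩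
    push_cast
    rw [sub_zero, ← hM]
    rcases hi.eq_or_lt with rfl | hi
    · exact hin
    · linarith [hbefore i hi]
  have hdisp := norm_sub_le_of_not_isIrregular (scaleLength_pos hN j) (scaleTime_pos hk j)
    (hreg j hJj) hwalk
  rw [SimpleGraph.Walk.getVert_zero, sub_zero] at hdisp
  -- As `34 = 2 * 17`, the additive error `17 N_j` is at most half the displacement. As `2M = 34M /
  -- 17`, stopping early costs a factor at most 17. With the speed bound `2N` this gives `17 * 2 *
  -- 2N = 68N`.
  have hmin1 : 34 * (scaleLength k N j : ℝ) ≤ min ‖x‖ (2 * M) := le_min hlo (by linarith)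
  have hmin2 : ‖x‖ / 17 ≤ min ‖x‖ (2 * M) :=
    le_min (by linarith [norm_nonneg x]) (by linarith)
  have hspeed := scaleLength_le_scaleTime hk N j
  have h1 : (scaleLength k N j : ℝ) * ((t : ℝ) / scaleTime k j) ≤ 2 * N * w.length := by
    have h2 : (t : ℝ) ≤ w.length := by exact_mod_cast ht3
    calc (scaleLength k N j : ℝ) * ((t : ℝ) / scaleTime k j)
        ≤ (2 * N * scaleTime k j) * ((t : ℝ) / scaleTime k j) := by gcongr
      _ = 2 * N * t := by field_simp
      _ ≤ 2 * N * w.length := by gcongr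
  linarith

/-! ### Comparison with the Euclidean norm and conclusion -/

lemma norm_le_latticeNorm {d : ℕ} (x : Fin d → ℤ) : ‖x‖ ≤ latticeNorm x := by
  refine (pi_norm_le_iff_of_nonneg (norm_nonneg _)).2 fun i => ?_
  have := PiLp.norm_apply_le (WithLp.toLp 2 (fun i => (x i : ℝ)) : EuclideanSpace ℝ (Fin d)) i
  simpa [latticeNorm, Int.norm_eq_abs] using this

lemma latticeNorm_le {d : ℕ} (x : Fin d → ℤ) : latticeNorm x ≤ d * ‖x‖ := by
  rw [latticeNorm, EuclideanSpace.norm_eq, Real.sqrt_le_left (by positivity)]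
  have h1 : ∀ i ∈ Finset.univ, ‖(x i : ℝ)‖ ^ 2 ≤ ‖x‖ ^ 2 := fun i _ => by
    have := norm_le_pi_norm x i
    rw [Int.norm_eq_abs] at this
    rw [Real.norm_eq_abs]
    gcongr
  refine (Finset.sum_le_card_nsmul _ _ _ h1).trans ?_
  rw [Finset.card_univ, Fintype.card_fin, nsmul_eq_mul, mul_pow]
  gcongr
  exact_mod_cast Nat.le_self_pow two_ne_zero d

lemma exists_bound_of_tendsto {d : ℕ} {p : (Fin d → ℤ) → ℝ} {s L : ℝ} (hs : 0 ≤ s) (hL : 0 < L)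
    (h : Tendsto (fun k => p k / latticeNorm k ^ (-s)) (latticeAtInfinity d) (𝓝 L)) :
    ∃ B : ℝ, ∀ k : Fin d → ℤ, B ≤ ‖k‖ → p k ≤ (L + 1) * ‖k‖ ^ (-s) := by
  have h1 := h.eventually_le_const (lt_add_one L)
  rw [latticeAtInfinity, eventually_comap, eventually_atTop] at h1
  obtain ⟨B, hB⟩ := h1
  refine ⟨max B 1, fun k hk => ?_⟩
  have hk0 : 0 < ‖k‖ := lt_of_lt_of_le one_pos ((le_max_right _ _).trans hk)
  have hkl := norm_le_latticeNorm k
  have h2 := hB _ ((le_max_left _ _).trans (hk.trans hkl)) k rfl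
  rw [div_le_iff₀ (Real.rpow_pos_of_pos (hk0.trans_le hkl) _)] at h2
  refine h2.trans (mul_le_mul_of_nonneg_left ?_ (by positivity))
  exact Real.rpow_le_rpow_of_nonpos hk0 hkl (neg_nonpos.2 hs)

/-- For disconnected points the hypothesis is vacuous, but the distance is infinite. -/
lemma ofReal_le_chemicalDist {d : ℕ} {Ω : Type*} {ω : Sym2 (Fin d → ℤ) → Ω → Bool} {a : Ω}
    {x y : Fin d → ℤ} {r : ℝ} (h : ∀ w : (openGraph ω a).Walk x y, r ≤ w.length) :
    ENNReal.ofReal r ≤ chemicalDist ω a x y := by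
  rw [chemicalDist]
  by_cases hr : (openGraph ω a).Reachable x y
  · obtain ⟨w, hw⟩ := hr.exists_walk_length_eq_edist
    rw [← hw, ENat.toENNReal_coe]
    exact ENNReal.ofReal_le_of_le_toReal (by simpa using h w)
  · rw [SimpleGraph.edist_eq_top_of_not_reachable hr]
    simp

theorem theorem1 {d : ℕ} (hd : 1 ≤ d) {s : ℝ} (hs : 2 * (d : ℝ) < s)
    (p : (Fin d → ℤ) → ℝ) (hp01 : ∀ k, p k ∈ Set.Icc (0 : ℝ) 1) (hpsymm : ∀ k, p (-k) = p k)
    (hplim : ∃ L : ℝ, 0 < L ∧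
      Tendsto (fun k => p k / latticeNorm k ^ (-s)) (latticeAtInfinity d) (𝓝 L))
    {Ω : Type*} [MeasurableSpace Ω] (μ : Measure Ω) [IsProbabilityMeasure μ]
    (ω : Sym2 (Fin d → ℤ) → Ω → Bool) (hω : IsLongRangePercolation μ p ω) :
    ∀ᵐ a ∂μ, 0 < liminf
      (fun x : Fin d → ℤ => chemicalDist ω a 0 x / ENNReal.ofReal (latticeNorm x))
      (latticeAtInfinity d) := by
  obtain ⟨L, hL, hlim⟩ := hplim
  have hs0 : 0 ≤ s := le_trans (by positivity) hs.le
  obtain ⟨B, hB⟩ := exists_bound_of_tendsto hs0 hL hlim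
  obtain ⟨k, N, hk, hN, hae⟩ := hω.ae_eventually_not_isIrregular hd hs (by positivity) hB
  filter_upwards [hae] with a ha
  obtain ⟨J, hJ⟩ := eventually_atTop.1 ha
  have hd' : (0 : ℝ) < d := by exact_mod_cast hd
  have hN' : (0 : ℝ) < N := by exact_mod_cast hN
  have hc : (0 : ℝ) < ((d : ℝ) * (68 * N))⁻¹ := by positivity
  refine (ENNReal.ofReal_pos.2 hc).trans_le (le_liminf_of_le (by isBoundedDefault) ?_)
  -- The factor `d` converts the Euclidean threshold into the sup-norm one.
  have hev : ∀ᶠ x in latticeAtInfinity d, d * (34 * (scaleLength k N J : ℝ)) ≤ latticeNorm x :=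
    tendsto_comap.eventually_ge_atTop _
  filter_upwards [hev] with x hx
  have hx1 : 34 * (scaleLength k N J : ℝ) ≤ ‖x‖ :=
    le_of_mul_le_mul_left (hx.trans (latticeNorm_le x)) hd'
  have hx0 : 0 < latticeNorm x := by
    have : (0 : ℝ) < scaleLength k N J := by exact_mod_cast scaleLength_pos hN J
    exact lt_of_lt_of_le (by positivity) hx
  rw [ENNReal.le_div_iff_mul_le (Or.inl (ENNReal.ofReal_pos.2 hx0).ne')
    (Or.inl ENNReal.ofReal_ne_top), ← ENNReal.ofReal_mul hc.le]
  refine ofReal_le_chemicalDist fun w => ?_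
  have h1 := norm_le_mul_length hk hN hJ hx1 w
  have h2 := latticeNorm_le x
  rw [inv_mul_le_iff₀ (by positivity)]
  calc latticeNorm x ≤ d * ‖x‖ := h2
    _ ≤ d * (68 * N * w.length) := by gcongr
    _ = d * (68 * N) * w.length := by ring
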